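/- Let $n\ge 2$, $\alpha>0$ and $r>0$. Let $\Gamma\subset\mathbb R^n$ be an open cone, invariant under permutations of the coordinates, with $\Gamma_+=\{\lambda\in\mathbb R^n:\lambda_i>0\ \forall i\}\subset\Gamma$, and let $\gamma:\Gamma\to(0,\infty)$ be a function such that a) $\gamma$ is smooth and symmetric: $\gamma(\lambda_{\sigma(1)},\dots,\lambda_{\sigma(n)})=\gamma(\lambda_1,\dots,\lambda_n)$ for every permutation $\sigma$; b) $\gamma$ is $\alpha$-homogeneous: $\gamma(c\lambda)=c^\alpha\gamma(\lambda)$ for all $\lambda\in\Gamma$ and $c>0$; c) $\frac{\partial\gamma}{\partial\lambda_i}(\lambda)>0$ for all $\lambda\in\Gamma$ and $i=1,\dots,n$; d) there is a continuous function $\tilde\gamma:\overline\Gamma\to[0,\infty)$ with $\tilde\gamma|_\Gamma=\gamma$ and $\tilde\gamma|_{\partial\Gamma}=0$. Let $B_r^n(0)\subset\mathbb R^n$ be the open ball, $u:B_r^n(0)\to\mathbb R$ a smooth function and $\Sigma=\{(x,u(x)):x\in B_r^n(0)\}\subset\mathbb R^{n+1}$ its graph, with unit normal $\nu=(-Du,1)/\sqrt{1+|Du|^2}$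 and principal curvatures $\lambda_1(p)\le\dots\le\lambda_n(p)$ at $p\in\Sigma$, i.e. the eigenvalues of the Weingarten map $h^i_j=g^{ik}h_{kj}$, where $g_{ij}=\langle\partial_iX,\partial_jX\rangle$, $h_{ij}=\langle\partial_i\partial_jX,\nu\rangle$ and $X(x)=(x,u(x))$. Write $\lambda=(\lambda_1,\dots,\lambda_n)$. Suppose that 1. $\Sigma$ is complete for its intrinsic distance; 2. $\Sigma$ is a $\gamma$-translator: $\lambda(p)\in\Gamma$ and $\gamma(\lambda(p))=\langle\nu(p),e_{n+1}\rangle$ for every $p\in\Sigma$; 3. $\Sigma$ is strictly convex: $\lambda(p)\in\Gamma_+$ for every $p\in\Sigma$; 4. $\Sigma$ has a single end, and this end is $\mathcal C^2$-asymptotic to the cylinder $\mathbb S^{n-1}(r)\times\mathbb R$, in the sense that $\lambda_1(p)\to0$ and $\lambda_i(p)\to\frac1r$ for every $i\in\{2,\dots,n\}$, as $|p|\to\infty$ in $\Sigma$. Then $\Sigma$ is rotationally symmetric with respect to the $x_{n+1}$-axis: $A(\Sigma)=\Sigma$ for every linear isometry $A$ of $\mathbb R^{n+1}$ with $A e_{n+1}=e_{n+1}$.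 -/

import Mathlib

open Set Filter Topology Metric
open scoped ContDiff ENNReal

noncomputable section

/-- Euclidean space `ℝ^m`. -/
abbrev Euc (m : ℕ) : Type := EuclideanSpace ℝ (Fin m)

/-! ### The curvature function -/

/-- The structural conditions on the speed function `γ : Γ → (0, ∞)`: `Γ ⊆ ℝ^n` is a symmetric
open cone containing the positive cone; `γ` is positive, smooth and symmetric, homogeneous of
degree `α > 0`, strictly increasing in each argument (positive partial derivatives), and it extends
continuously to the closure of `Γ` with value `0` on the boundary of `Γ`. (The values of `γ`
outside `Γ` are irrelevant.) -/
structure IsSpeedFunction {n : ℕ} (Γ : Set (Fin n → ℝ)) (γ : (Fin n → ℝ) → ℝ) (α : ℝ) : Prop where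
  isOpen : IsOpen Γ
  cone : ∀ l ∈ Γ, ∀ c : ℝ, 0 < c → c • l ∈ Γ
  symm_domain : ∀ l ∈ Γ, ∀ σ : Equiv.Perm (Fin n), l ∘ σ ∈ Γ
  pos_cone_subset : {l : Fin n → ℝ | ∀ i, 0 < l i} ⊆ Γ
  pos : ∀ l ∈ Γ, 0 < γ l
  smooth : ContDiffOn ℝ ∞ γ Γ
  symm : ∀ l ∈ Γ, ∀ σ : Equiv.Perm (Fin n), γ (l ∘ σ) = γ l
  degree_pos : 0 < α
  homogeneous : ∀ l ∈ Γ, ∀ c : ℝ, 0 < c → γ (c • l) = c ^ α * γ l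
  increasing : ∀ l ∈ Γ, ∀ i : Fin n, 0 < fderiv ℝ γ l (Pi.single i 1)
  boundary : ∃ γ' : (Fin n → ℝ) → ℝ, ContinuousOn γ' (closure Γ) ∧ (∀ l ∈ closure Γ, 0 ≤ γ' l) ∧
    EqOn γ' γ Γ ∧ ∀ l ∈ frontier Γ, γ' l = 0

/-! ### Geometry of parametrized hypersurfaces -/

/-- The coordinate tangent vector `∂_i X` of a parametrization `X`. -/
def tangentVec {n : ℕ} (X : Euc n → Euc (n + 1)) (x : Euc n) (i : Fin n) : Euc (n + 1) :=
  fderiv ℝ X x (EuclideanSpace.single i 1)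

/-- The coordinate second derivative `∂_i ∂_j X`. -/
def secondDeriv {n : ℕ} (X : Euc n → Euc (n + 1)) (x : Euc n) (i j : Fin n) : Euc (n + 1) :=
  fderiv ℝ (fun y => tangentVec X y j) x (EuclideanSpace.single i 1)

/-- The induced metric `g_ij = ⟨∂_i X, ∂_j X⟩`. -/
def metricMatrix {n : ℕ} (X : Euc n → Euc (n + 1)) (x : Euc n) : Matrix (Fin n) (Fin n) ℝ :=
  Matrix.of fun i j => inner ℝ (tangentVec X x i) (tangentVec X x j)

/-- The second fundamental form `h_ij = ⟨∂_i ∂_j X, ν⟩` with respect to the unit normal `ν`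
(positive definite when the hypersurface bends strictly towards `ν`). -/
def secondFundForm {n : ℕ} (X ν : Euc n → Euc (n + 1)) (x : Euc n) : Matrix (Fin n) (Fin n) ℝ :=
  Matrix.of fun i j => inner ℝ (secondDeriv X x i j) (ν x)

/-- The matrix `h^i_j = g^{ik} h_kj` of the Weingarten map. -/
def weingarten {n : ℕ} (X ν : Euc n → Euc (n + 1)) (x : Euc n) : Matrix (Fin n) (Fin n) ℝ :=
  (metricMatrix X x)⁻¹ * secondFundForm X ν x

/-- The principal curvatures `λ_1 ≤ ... ≤ λ_n`: the eigenvalues of the Weingarten map, listed with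
multiplicity in increasing order. (The Weingarten map of an immersion is diagonalizable over `ℝ`,
so that there are exactly `n` of them and the default value `0` is never used.) -/
def principalCurvatures {n : ℕ} (X ν : Euc n → Euc (n + 1)) (x : Euc n) : Fin n → ℝ :=
  fun i => ((weingarten X ν x).charpoly.roots.sort (· ≤ ·)).getD i 0

/-! ### Graphs -/

/-- The direction `e_{n+1}` of translation. -/
def eLast (n : ℕ) : Euc (n + 1) := EuclideanSpace.single (Fin.last n) 1

/-- The graph parametrization `x ↦ (x, u x)`. -/
def graphMap {n : ℕ} (u : Euc n → ℝ) (x : Euc n) : Euc (n + 1) :=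
  WithLp.toLp 2 (Fin.snoc (α := fun _ => ℝ) (fun i => x i) (u x))

/-- The projection `(x, x_{n+1}) ↦ x`. -/
def baseProj {n : ℕ} (p : Euc (n + 1)) : Euc n :=
  WithLp.toLp 2 fun i : Fin n => p i.castSucc

/-- The upward unit normal `(-Du, 1) / √(1 + |Du|²)` of the graph of `u`. It is the inward normal
of a graph which is convex with respect to it. -/
def graphNormal {n : ℕ} (u : Euc n → ℝ) (x : Euc n) : Euc (n + 1) :=
  (Real.sqrt (1 + ‖gradient u x‖ ^ 2))⁻¹ •
    WithLp.toLp 2 (Fin.snoc (α := fun _ => ℝ) (fun i => -gradient u x i) 1)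

/-- The principal curvatures of the graph of `u` at its point `p`, with respect to the upward unit
normal. -/
def graphCurvatures {n : ℕ} (u : Euc n → ℝ) (p : Euc (n + 1)) : Fin n → ℝ :=
  principalCurvatures (graphMap u) (graphNormal u) (baseProj p)

/-! ### Completeness, ends, asymptotics, symmetry -/

/-- The intrinsic distance of two points of `S`: the infimum of the lengths of the curves in `S`
that join them (`∞` if there is none). -/
def intrinsicEDist {m : ℕ} (S : Set (Euc m)) (p q : Euc m) : ℝ≥0∞ :=
  ⨅ (c : ℝ → Euc m) (_ : ContinuousOn c (Icc 0 1) ∧ MapsTo c (Icc 0 1) S ∧ c 0 = p ∧ c 1 = q),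
    eVariationOn c (Icc 0 1)

/-- Metric completeness of `S` for its intrinsic distance: intrinsic Cauchy sequences converge
in `S`. -/
def IsIntrinsicallyComplete {m : ℕ} (S : Set (Euc m)) : Prop :=
  ∀ p : ℕ → Euc m, (∀ k, p k ∈ S) →
    (∀ ε : ℝ≥0∞, 0 < ε → ∃ N, ∀ j ≥ N, ∀ k ≥ N, intrinsicEDist S (p j) (p k) < ε) →
    ∃ q ∈ S, Tendsto (fun k => intrinsicEDist S (p k) q) atTop (𝓝 0)

/-- `S` has a single end: for every compact `K ⊆ S`, exactly one connected component of `S \ K`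
is not relatively compact in `S`. -/
def HasSingleEnd {m : ℕ} (S : Set (Euc m)) : Prop :=
  ∀ K : Set (Euc m), IsCompact K → K ⊆ S →
    ∃! C : Set (Euc m), (∃ p ∈ S \ K, C = connectedComponentIn (S \ K) p) ∧
      ¬ ∃ L : Set (Euc m), IsCompact L ∧ L ⊆ S ∧ C ⊆ L

/-- The graph `S` with principal curvatures `κ` (in increasing order) is `C²`-asymptotic to the
cylinder `𝕊^{n-1}(r) × ℝ`: as `|p| → ∞` on `S`, the smallest principal curvature tends to `0` and
all the others tend to `1 / r`. -/
def IsAsymptoticToCylinder {n : ℕ} (S : Set (Euc (n + 1))) (κ : Euc (n + 1) → Fin n → ℝ)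
    (r : ℝ) : Prop :=
  ∀ i : Fin n, Tendsto (fun p => κ p i) (comap (fun p => ‖p‖) atTop ⊓ 𝓟 S)
    (𝓝 (if (i : ℕ) = 0 then 0 else 1 / r))

/-- `S` is rotationally symmetric about the `x_{n+1}`-axis: it is invariant under every linear
isometry of `ℝ^{n+1}` that fixes `e_{n+1}`. -/
def IsRotationallySymmetric {n : ℕ} (S : Set (Euc (n + 1))) : Prop :=
  ∀ A : Euc (n + 1) ≃ₗᵢ[ℝ] Euc (n + 1), A (eLast n) = eLast n → A '' S = S

/-- `S` is a `γ`-translator (in the direction `e_{n+1}`) given as the graph of `u`: at each of its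
points the principal curvature vector `λ` belongs to the domain `Γ` of `γ`, and
`γ(λ) = ⟨ν, e_{n+1}⟩`. -/
def IsGraphTranslator {n : ℕ} (Γ : Set (Fin n → ℝ)) (γ : (Fin n → ℝ) → ℝ) (u : Euc n → ℝ)
    (S : Set (Euc (n + 1))) : Prop :=
  ∀ p ∈ S, graphCurvatures u p ∈ Γ ∧
    γ (graphCurvatures u p) = inner ℝ (graphNormal u (baseProj p)) (eLast n)

end

/-!
Completeness forces the convex function `u` to blow up at the boundary of the ball: along a radius
on which `u` stays bounded the graph has finite length, hence it would have a limit point in the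
graph lying over the boundary.

Let `ρ` be the reflection in the hyperplane `⟨x, e⟩ = t` with `t > 0`, and suppose that
`u < u ∘ ρ` somewhere in the cap `⟨x, e⟩ ≥ t`. By convexity, `u` is bounded on the set where this
happens, so for `c < 1` close to `1` the difference of `u` and of the shrunk reflected function
`c * u (c⁻¹ • ρ x)` has an interior minimum there. At it the two graphs have the same slope, while
the curvatures of the first are at least those of the second, which are those of the original graph
multiplied by `c⁻¹ > 1`. This contradicts the translator equation, as `γ` is strictly increasing on
the positive cone. Hence `u ∘ ρ ≤ u` on the cap. Letting `t → 0` shows that `u` is invariant under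
all reflections in hyperplanes through the center, that is, radial.
-/

section LinearAlgebra

open Matrix

lemma sort_map_univ_eq_ofFn {α : Type*} [LinearOrder α] {n : ℕ} (f : Fin n → α) :
    (Finset.univ.val.map f).sort (· ≤ ·) = List.ofFn (f ∘ Tuple.sort f) := by
  refine List.Perm.eq_of_sortedLE (Multiset.pairwise_sort _ _).sortedLE
    (Tuple.monotone_sort f).sortedLE_ofFn ?_
  rw [← Multiset.coe_eq_coe, Multiset.sort_eq, Fin.univ_val_map, Multiset.coe_eq_coe]
  exact ((Tuple.sort f).ofFn_comp_perm f).symm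

variable {ι : Type*} [Fintype ι] [DecidableEq ι]

open scoped MatrixOrder in
lemma exists_simultaneous_diagonalization {g h : Matrix ι ι ℝ} (hg : g.PosDef)
    (hh : h.IsHermitian) :
    ∃ (P : Matrix ι ι ℝ) (d : ι → ℝ), Pᵀ * g * P = 1 ∧ Pᵀ * h * P = diagonal d := by
  obtain ⟨D, hD⟩ := CStarAlgebra.nonneg_iff_eq_star_mul_self.mp hg.inv.posSemidef.nonneg
  have hDg : D * g * Dᵀ = 1 := by
    rw [mul_eq_one_comm, ← mul_assoc, ← conjTranspose_eq_transpose_of_trivial,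
      ← star_eq_conjTranspose, ← hD, nonsing_inv_mul _ ((isUnit_iff_isUnit_det g).mp hg.isUnit)]
  have hA : (D * h * Dᵀ).IsHermitian := by
    simpa using isHermitian_mul_mul_conjTranspose D hh
  set U : Matrix ι ι ℝ := hA.eigenvectorUnitary.1
  have hU : Uᵀ * U = 1 := by
    simpa [star_eq_conjTranspose] using mem_unitaryGroup_iff'.mp hA.eigenvectorUnitary.2
  have hUA : Uᵀ * (D * h * Dᵀ) * U = diagonal hA.eigenvalues := by
    simpa [Unitary.conjStarAlgAut_apply, star_eq_conjTranspose]
      using hA.conjStarAlgAut_star_eigenvectorUnitary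
  have hconj (k : Matrix ι ι ℝ) : (Dᵀ * U)ᵀ * k * (Dᵀ * U) = Uᵀ * (D * k * Dᵀ) * U := by
    simp only [transpose_mul, transpose_transpose, mul_assoc]
  refine ⟨Dᵀ * U, hA.eigenvalues, ?_, ?_⟩
  · rw [hconj, hDg, mul_one, hU]
  · rw [hconj, hUA]

lemma charpoly_inv_mul_eq {g h P : Matrix ι ι ℝ} {d : ι → ℝ} (hg : Pᵀ * g * P = 1)
    (hh : Pᵀ * h * P = diagonal d) : (g⁻¹ * h).charpoly = (diagonal d).charpoly := by
  have hinv : g⁻¹ = P * Pᵀ :=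
    inv_eq_left_inv (by rw [mul_assoc]; exact mul_eq_one_comm.mp hg)
  rw [hinv, mul_assoc, charpoly_mul_comm, hh]

lemma exists_sorted_simultaneous_diagonalization {n : ℕ} {g h : Matrix (Fin n) (Fin n) ℝ}
    (hg : g.PosDef) (hh : h.IsHermitian) {κ : Fin n → ℝ}
    (hκ : ∀ i : Fin n, κ i = ((g⁻¹ * h).charpoly.roots.sort (· ≤ ·)).getD i 0) :
    Monotone κ ∧ ∃ P : Matrix (Fin n) (Fin n) ℝ, Pᵀ * g * P = 1 ∧ Pᵀ * h * P = diagonal κ := by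
  obtain ⟨P, d, hPg, hPh⟩ := exists_simultaneous_diagonalization hg hh
  have hroots : (g⁻¹ * h).charpoly.roots = Finset.univ.val.map d := by
    rw [charpoly_inv_mul_eq hPg hPh, charpoly_diagonal,
      ← Polynomial.roots_multiset_prod_X_sub_C (Finset.univ.val.map d), Multiset.map_map]
    rfl
  obtain rfl : κ = d ∘ Tuple.sort d := by
    ext i
    rw [hκ, hroots, sort_map_univ_eq_ofFn]
    simp
  have hconj (k : Matrix (Fin n) (Fin n) ℝ) :
      (P.submatrix id (Tuple.sort d))ᵀ * k * P.submatrix id (Tuple.sort d) =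
        (Pᵀ * k * P).submatrix (Tuple.sort d) (Tuple.sort d) := rfl
  refine ⟨Tuple.monotone_sort d, P.submatrix id (Tuple.sort d), ?_, ?_⟩
  · rw [hconj, hPg, submatrix_one_equiv]
  · rw [hconj, hPh, submatrix_diagonal_equiv]

/-- One half of the Courant–Fischer principle: some `a ≠ 0` has `a i = 0` for `k < i` and
`T a i = 0` for `i < k`. -/
lemma diagonal_coeff_le_of_form_le {n : ℕ} (T : (Fin n → ℝ) →ₗ[ℝ] (Fin n → ℝ))
    {κ μ : Fin n → ℝ} (hκ : Monotone κ) (hμ : Monotone μ)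
    (hT : ∀ a, ∑ i, T a i ^ 2 = ∑ i, a i ^ 2)
    (hle : ∀ a, ∑ i, μ i * T a i ^ 2 ≤ ∑ i, κ i * a i ^ 2) (k : Fin n) : μ k ≤ κ k := by
  let L : (Fin n → ℝ) →ₗ[ℝ] (Fin n → ℝ) := LinearMap.pi fun i =>
    if i < k then LinearMap.proj i ∘ₗ T else if k < i then LinearMap.proj i else 0
  obtain ⟨a, haL, ha⟩ : ∃ a, L a = 0 ∧ a ≠ 0 := by
    by_contra! hker
    obtain ⟨a, ha⟩ := LinearMap.injective_iff_surjective.mp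
      ((injective_iff_map_eq_zero L).mpr hker) (Pi.single k 1)
    simpa [L] using congrFun ha k
  have hTa : ∀ i < k, T a i = 0 := fun i hi => by simpa [L, hi] using congrFun haL i
  have haz : ∀ i, k < i → a i = 0 := fun i hi => by
    simpa [L, hi, hi.not_gt] using congrFun haL i
  have hpos : 0 < ∑ i, a i ^ 2 := by
    obtain ⟨i, hi⟩ := Function.ne_iff.mp ha
    exact Finset.sum_pos' (fun _ _ => sq_nonneg _) ⟨i, Finset.mem_univ _, sq_pos_of_ne_zero hi⟩
  refine le_of_mul_le_mul_right ?_ hpos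
  calc μ k * ∑ i, a i ^ 2 = ∑ i, μ k * T a i ^ 2 := by rw [← hT, Finset.mul_sum]
    _ ≤ ∑ i, μ i * T a i ^ 2 := Finset.sum_le_sum fun i _ => by
        rcases lt_or_ge i k with hi | hi
        · simp [hTa i hi]
        · exact mul_le_mul_of_nonneg_right (hμ hi) (sq_nonneg _)
    _ ≤ ∑ i, κ i * a i ^ 2 := hle a
    _ ≤ ∑ i, κ k * a i ^ 2 := Finset.sum_le_sum fun i _ => by
        rcases lt_or_ge k i with hi | hi
        · simp [haz i hi]
        · exact mul_le_mul_of_nonneg_right (hκ hi) (sq_nonneg _)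
    _ = κ k * ∑ i, a i ^ 2 := by rw [Finset.mul_sum]

end LinearAlgebra

section Hypersurface

open Matrix

variable {n : ℕ} {X ν Y μ : Euc n → Euc (n + 1)} {x y : Euc n}

lemma sum_smul_single (v : Euc n) : ∑ i, v i • EuclideanSpace.single i (1 : ℝ) = v := by
  simpa using (EuclideanSpace.basisFun (Fin n) ℝ).sum_repr v

lemma sum_smul_tangentVec (X : Euc n → Euc (n + 1)) (x v : Euc n) :
    ∑ i, v i • tangentVec X x i = fderiv ℝ X x v := by
  simp_rw [tangentVec, ← map_smul, ← map_sum, sum_smul_single]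

lemma metricMatrix_eq_gram (X : Euc n → Euc (n + 1)) (x : Euc n) :
    metricMatrix X x = gram ℝ (tangentVec X x) := rfl

lemma dotProduct_metricMatrix_mulVec (X : Euc n → Euc (n + 1)) (x v : Euc n) :
    v.ofLp ⬝ᵥ metricMatrix X x *ᵥ v.ofLp = ‖fderiv ℝ X x v‖ ^ 2 := by
  rw [metricMatrix_eq_gram, ← sum_smul_tangentVec, ← real_inner_self_eq_norm_sq]
  exact star_dotProduct_gram_mulVec _ _ _

lemma posDef_metricMatrix (hX : Function.Injective (fderiv ℝ X x)) :
    (metricMatrix X x).PosDef := by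
  have htangent : tangentVec X x = fderiv ℝ X x ∘ EuclideanSpace.basisFun (Fin n) ℝ := by
    ext1 i
    simp [tangentVec]
  rw [metricMatrix_eq_gram, htangent]
  exact posDef_gram_of_linearIndependent
    ((EuclideanSpace.basisFun (Fin n) ℝ).toBasis.linearIndependent.map'
      (fderiv ℝ X x).toLinearMap (LinearMap.ker_eq_bot.mpr hX))

lemma secondDeriv_eq_fderiv_fderiv (hX : DifferentiableAt ℝ (fderiv ℝ X) x) (i j : Fin n) :
    secondDeriv X x i j =
      fderiv ℝ (fderiv ℝ X) x (EuclideanSpace.single i 1) (EuclideanSpace.single j 1) := by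
  have := fderiv_clm_apply hX (differentiableAt_const (EuclideanSpace.single j (1 : ℝ)))
  simp [secondDeriv, tangentVec, this]

lemma dotProduct_secondFundForm_mulVec (ν : Euc n → Euc (n + 1))
    (hX : DifferentiableAt ℝ (fderiv ℝ X) x) (v : Euc n) :
    v.ofLp ⬝ᵥ secondFundForm X ν x *ᵥ v.ofLp =
      inner ℝ (fderiv ℝ (fderiv ℝ X) x v v) (ν x) := by
  conv_rhs => rw [← sum_smul_single v]
  simp only [dotProduct, mulVec, secondFundForm, of_apply, secondDeriv_eq_fderiv_fderiv hX,
    map_sum, map_smul, _root_.sum_apply, _root_.smul_apply, sum_inner, real_inner_smul_left,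
    Finset.mul_sum]
  rw [Finset.sum_comm]
  exact Finset.sum_congr rfl fun i _ => Finset.sum_congr rfl fun j _ => by ring

lemma isHermitian_secondFundForm (ν : Euc n → Euc (n + 1)) (hX : ContDiffAt ℝ 2 X x) :
    (secondFundForm X ν x).IsHermitian := by
  have hd : DifferentiableAt ℝ (fderiv ℝ X) x :=
    (hX.fderiv_right (m := 1) (by norm_num)).differentiableAt (by norm_num)
  ext i j
  simp only [secondFundForm, conjTranspose_apply, of_apply, secondDeriv_eq_fderiv_fderiv hd,
    star_trivial]
  rw [hX.isSymmSndFDerivAt (by simp)]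

lemma exists_principal_frame (ν : Euc n → Euc (n + 1)) (hX : ContDiffAt ℝ 2 X x)
    (himm : Function.Injective (fderiv ℝ X x)) :
    Monotone (principalCurvatures X ν x) ∧ ∃ E : (Fin n → ℝ) ≃ₗ[ℝ] Euc n,
      (∀ a, ‖fderiv ℝ X x (E a)‖ ^ 2 = ∑ i, a i ^ 2) ∧
      ∀ a, inner ℝ (fderiv ℝ (fderiv ℝ X) x (E a) (E a)) (ν x) =
        ∑ i, principalCurvatures X ν x i * a i ^ 2 := by
  have hd : DifferentiableAt ℝ (fderiv ℝ X) x :=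
    (hX.fderiv_right (m := 1) (by norm_num)).differentiableAt (by norm_num)
  obtain ⟨hmono, P, hPg, hPh⟩ := exists_sorted_simultaneous_diagonalization
    (posDef_metricMatrix himm) (isHermitian_secondFundForm ν hX)
    (κ := principalCurvatures X ν x) fun i => rfl
  have hform (k : Matrix (Fin n) (Fin n) ℝ) (a : Fin n → ℝ) :
      (P *ᵥ a) ⬝ᵥ k *ᵥ (P *ᵥ a) = a ⬝ᵥ (Pᵀ * k * P) *ᵥ a := by
    rw [← mulVec_mulVec, ← mulVec_mulVec, dotProduct_mulVec a, vecMul_transpose]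
  obtain ⟨E, hE⟩ : ∃ E : (Fin n → ℝ) ≃ₗ[ℝ] Euc n, ∀ a, (E a).ofLp = P *ᵥ a :=
    ⟨(toLinearEquiv' P (invertibleOfLeftInverse P _ hPg)).trans
      (WithLp.linearEquiv 2 ℝ (Fin n → ℝ)).symm, fun _ => rfl⟩
  refine ⟨hmono, E, fun a => ?_, fun a => ?_⟩
  · rw [← dotProduct_metricMatrix_mulVec, hE, hform, hPg, one_mulVec]
    simp only [dotProduct, sq]
  · rw [← dotProduct_secondFundForm_mulVec ν hd, hE, hform, hPh]
    simp only [dotProduct, mulVec_diagonal]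
    exact Finset.sum_congr rfl fun i _ => by ring

lemma secondFundForm_nonneg (ν : Euc n → Euc (n + 1)) (hX : ContDiffAt ℝ 2 X x)
    (himm : Function.Injective (fderiv ℝ X x)) (hκ : ∀ i, 0 ≤ principalCurvatures X ν x i)
    (v : Euc n) : 0 ≤ inner ℝ (fderiv ℝ (fderiv ℝ X) x v v) (ν x) := by
  obtain ⟨-, E, -, hII⟩ := exists_principal_frame ν hX himm
  rw [← E.apply_symm_apply v, hII]
  exact Finset.sum_nonneg fun i _ => mul_nonneg (hκ i) (sq_nonneg _)

lemma mul_principalCurvatures_le (hX : ContDiffAt ℝ 2 X x)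
    (himmX : Function.Injective (fderiv ℝ X x)) (hY : ContDiffAt ℝ 2 Y y)
    (himmY : Function.Injective (fderiv ℝ Y y)) (L : Euc n →ₗ[ℝ] Euc n)
    (hmetric : ∀ v, ‖fderiv ℝ Y y (L v)‖ = ‖fderiv ℝ X x v‖) {c : ℝ} (hc : 0 ≤ c)
    (hform : ∀ v, c * inner ℝ (fderiv ℝ (fderiv ℝ Y) y (L v) (L v)) (μ y) ≤
      inner ℝ (fderiv ℝ (fderiv ℝ X) x v v) (ν x)) (i : Fin n) :
    c * principalCurvatures Y μ y i ≤ principalCurvatures X ν x i := by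
  obtain ⟨hmonoX, E, hEg, hEh⟩ := exists_principal_frame ν hX himmX
  obtain ⟨hmonoY, F, hFg, hFh⟩ := exists_principal_frame μ hY himmY
  let T : (Fin n → ℝ) →ₗ[ℝ] (Fin n → ℝ) := F.symm.toLinearMap ∘ₗ L ∘ₗ E.toLinearMap
  have hFT (a) : F (T a) = L (E a) := F.apply_symm_apply _
  refine diagonal_coeff_le_of_form_le (μ := fun i => c * principalCurvatures Y μ y i) T hmonoX
    (fun i j hij => mul_le_mul_of_nonneg_left (hmonoY hij) hc) (fun a => ?_) (fun a => ?_) i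
  · rw [← hFg, hFT, hmetric, hEg]
  · simpa only [← hEh, ← hFT, hFh, Finset.mul_sum, mul_assoc] using hform (E a)

end Hypersurface

section Graph

variable {n : ℕ} {u v : Euc n → ℝ} {x y : Euc n}

/-- The inclusion of `ℝ^n` in `ℝ^{n+1}` as the hyperplane orthogonal to `eLast n`. -/
def horizontalIncl (n : ℕ) : Euc n →ₗᵢ[ℝ] Euc (n + 1) where
  toFun w := WithLp.toLp 2 (Fin.snoc (α := fun _ => ℝ) (fun i => w i) 0)
  map_add' v w := by
    ext i
    refine Fin.lastCases ?_ (fun j => ?_) i <;> simp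
  map_smul' c w := by
    ext i
    refine Fin.lastCases ?_ (fun j => ?_) i <;> simp
  norm_map' w := by simp [EuclideanSpace.norm_eq, Fin.sum_univ_castSucc]

@[simp] lemma horizontalIncl_last (w : Euc n) : horizontalIncl n w (Fin.last n) = 0 := by
  simp [horizontalIncl]

@[simp] lemma horizontalIncl_castSucc (w : Euc n) (i : Fin n) :
    horizontalIncl n w i.castSucc = w i := by
  simp [horizontalIncl]

@[simp] lemma eLast_last : eLast n (Fin.last n) = 1 := by simp [eLast]

@[simp] lemma eLast_castSucc (i : Fin n) : eLast n i.castSucc = 0 := by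
  simp [eLast, (Fin.castSucc_lt_last i).ne]

@[simp] lemma norm_eLast : ‖eLast n‖ = 1 := by simp [eLast]

@[simp] lemma inner_horizontalIncl_eLast (w : Euc n) :
    inner ℝ (horizontalIncl n w) (eLast n) = 0 := by
  simp [PiLp.inner_apply, Fin.sum_univ_castSucc]

lemma norm_horizontalIncl_add_smul_eLast_sq (w : Euc n) (s : ℝ) :
    ‖horizontalIncl n w + s • eLast n‖ ^ 2 = ‖w‖ ^ 2 + s ^ 2 := by
  rw [norm_add_sq_real]
  simp [real_inner_smul_right, norm_smul]

lemma graphMap_eq (u : Euc n → ℝ) (x : Euc n) :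
    graphMap u x = horizontalIncl n x + u x • eLast n := by
  ext i
  refine Fin.lastCases ?_ (fun j => ?_) i <;> simp [graphMap]

@[simp] lemma baseProj_graphMap (u : Euc n → ℝ) (x : Euc n) : baseProj (graphMap u x) = x := by
  ext i
  simp [baseProj, graphMap]

lemma inner_graphNormal_eLast (u : Euc n → ℝ) (x : Euc n) :
    inner ℝ (graphNormal u x) (eLast n) = (Real.sqrt (1 + ‖fderiv ℝ u x‖ ^ 2))⁻¹ := by
  simp [graphNormal, gradient, eLast, EuclideanSpace.inner_single_right]

lemma inner_graphNormal_eLast_pos (u : Euc n → ℝ) (x : Euc n) :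
    0 < inner ℝ (graphNormal u x) (eLast n) := by
  rw [inner_graphNormal_eLast]
  positivity

lemma contDiffAt_graphMap {k : WithTop ℕ∞} (hu : ContDiffAt ℝ k u x) :
    ContDiffAt ℝ k (graphMap u) x := by
  simp_rw [funext (graphMap_eq u)]
  exact (horizontalIncl n).contDiff.contDiffAt.add (hu.smul contDiffAt_const)

lemma fderiv_graphMap (hu : DifferentiableAt ℝ u x) :
    fderiv ℝ (graphMap u) x =
      (horizontalIncl n).toContinuousLinearMap + (fderiv ℝ u x).smulRight (eLast n) := by
  rw [funext (graphMap_eq u)]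
  exact ((horizontalIncl n).toContinuousLinearMap.hasFDerivAt.add
    (hu.hasFDerivAt.smul_const (eLast n))).fderiv

lemma norm_fderiv_graphMap_sq (hu : DifferentiableAt ℝ u x) (w : Euc n) :
    ‖fderiv ℝ (graphMap u) x w‖ ^ 2 = ‖w‖ ^ 2 + fderiv ℝ u x w ^ 2 := by
  rw [fderiv_graphMap hu]
  exact norm_horizontalIncl_add_smul_eLast_sq w _

lemma injective_fderiv_graphMap (hu : DifferentiableAt ℝ u x) :
    Function.Injective (fderiv ℝ (graphMap u) x) := by
  refine (injective_iff_map_eq_zero _).mpr fun w hw => ?_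
  have h := norm_fderiv_graphMap_sq hu w
  rw [hw, norm_zero] at h
  exact norm_eq_zero.mp (by nlinarith [sq_nonneg (fderiv ℝ u x w)])

lemma fderiv_fderiv_graphMap_apply (hu : ContDiffAt ℝ 2 u x) (w w' : Euc n) :
    fderiv ℝ (fderiv ℝ (graphMap u)) x w w' = fderiv ℝ (fderiv ℝ u) x w w' • eLast n := by
  have hd : DifferentiableAt ℝ (fderiv ℝ u) x :=
    (hu.fderiv_right (m := 1) (by norm_num)).differentiableAt (by norm_num)
  let smulE : (Euc n →L[ℝ] ℝ) →L[ℝ] Euc n →L[ℝ] Euc (n + 1) :=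
    (ContinuousLinearMap.smulRightL ℝ (Euc n) (Euc (n + 1))).flip (eLast n)
  have hev : fderiv ℝ (graphMap u) =ᶠ[𝓝 x] fun y =>
      (horizontalIncl n).toContinuousLinearMap + smulE (fderiv ℝ u y) := by
    filter_upwards [hu.eventually (by norm_num)] with y hy
    exact fderiv_graphMap (hy.differentiableAt (by norm_num))
  rw [(((smulE.hasFDerivAt.comp x hd.hasFDerivAt).const_add _).congr_of_eventuallyEq hev).fderiv]
  simp [smulE]

lemma inner_fderiv_fderiv_graphMap_graphNormal (hu : ContDiffAt ℝ 2 u x) (w w' : Euc n) :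
    inner ℝ (fderiv ℝ (fderiv ℝ (graphMap u)) x w w') (graphNormal u x) =
      fderiv ℝ (fderiv ℝ u) x w w' * inner ℝ (graphNormal u x) (eLast n) := by
  rw [fderiv_fderiv_graphMap_apply hu, real_inner_smul_left, real_inner_comm]

lemma hessian_nonneg_of_principalCurvatures_nonneg (hu : ContDiffAt ℝ 2 u x)
    (hκ : ∀ i, 0 ≤ principalCurvatures (graphMap u) (graphNormal u) x i) (w : Euc n) :
    0 ≤ fderiv ℝ (fderiv ℝ u) x w w := by
  have h := secondFundForm_nonneg (graphNormal u) (contDiffAt_graphMap hu)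
    (injective_fderiv_graphMap (hu.differentiableAt (by norm_num))) hκ w
  rw [inner_fderiv_fderiv_graphMap_graphNormal hu] at h
  exact nonneg_of_mul_nonneg_left h (inner_graphNormal_eLast_pos u x)

lemma inner_graphNormal_eLast_congr (R : Euc n ≃ₗᵢ[ℝ] Euc n)
    (hR : ∀ w, fderiv ℝ v y (R w) = fderiv ℝ u x w) :
    inner ℝ (graphNormal v y) (eLast n) = inner ℝ (graphNormal u x) (eLast n) := by
  have hcomp : fderiv ℝ u x = fderiv ℝ v y ∘L R.toContinuousLinearEquiv :=
    ContinuousLinearMap.ext fun w => (hR w).symm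
  rw [inner_graphNormal_eLast, inner_graphNormal_eLast, hcomp]
  simp

lemma mul_principalCurvatures_graph_le (hu : ContDiffAt ℝ 2 u x) (hv : ContDiffAt ℝ 2 v y)
    (R : Euc n ≃ₗᵢ[ℝ] Euc n) (hR : ∀ w, fderiv ℝ v y (R w) = fderiv ℝ u x w) {c : ℝ}
    (hc : 0 ≤ c)
    (hhess : ∀ w, c * fderiv ℝ (fderiv ℝ v) y (R w) (R w) ≤ fderiv ℝ (fderiv ℝ u) x w w)
    (i : Fin n) :
    c * principalCurvatures (graphMap v) (graphNormal v) y i ≤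
      principalCurvatures (graphMap u) (graphNormal u) x i := by
  have hdu := hu.differentiableAt (by norm_num)
  have hdv := hv.differentiableAt (by norm_num)
  refine mul_principalCurvatures_le (contDiffAt_graphMap hu) (injective_fderiv_graphMap hdu)
    (contDiffAt_graphMap hv) (injective_fderiv_graphMap hdv) R.toLinearEquiv.toLinearMap
    (fun w => ?_) hc (fun w => ?_) i
  · rw [← sq_eq_sq₀ (norm_nonneg _) (norm_nonneg _), norm_fderiv_graphMap_sq hdv,
      norm_fderiv_graphMap_sq hdu]
    simp [hR]
  · rw [inner_fderiv_fderiv_graphMap_graphNormal hu, inner_fderiv_fderiv_graphMap_graphNormal hv,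
      inner_graphNormal_eLast_congr R hR, ← mul_assoc]
    exact mul_le_mul_of_nonneg_right (hhess w) (inner_graphNormal_eLast_pos u x).le

end Graph

section IntrinsicDistance

variable {m : ℕ} {S : Set (Euc m)}

lemma edist_le_intrinsicEDist (S : Set (Euc m)) (p q : Euc m) :
    edist p q ≤ intrinsicEDist S p q := by
  refine le_iInf₂ fun c hc => ?_
  rw [← hc.2.2.1, ← hc.2.2.2]
  exact eVariationOn.edist_le c (by simp) (by simp)

lemma intrinsicEDist_comm (S : Set (Euc m)) (p q : Euc m) :
    intrinsicEDist S p q = intrinsicEDist S q p := by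
  suffices h : ∀ p q, intrinsicEDist S p q ≤ intrinsicEDist S q p from (h p q).antisymm (h q p)
  refine fun p q => le_iInf₂ fun c hc => ?_
  have hmaps : MapsTo (fun t : ℝ => 1 - t) (Icc 0 1) (Icc 0 1) := fun t ht =>
    ⟨sub_nonneg.mpr ht.2, sub_le_self _ ht.1⟩
  refine (iInf₂_le (c ∘ fun t : ℝ => 1 - t) ⟨hc.1.comp (by fun_prop) hmaps,
    hc.2.1.comp hmaps, by simpa using hc.2.2.2, by simpa using hc.2.2.1⟩).trans ?_
  exact eVariationOn.comp_le_of_antitoneOn c _ (fun s _ t _ hst => sub_le_sub_left hst 1) hmaps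

lemma intrinsicEDist_le_eVariationOn {c : ℝ → Euc m} {a b : ℝ} (hab : a ≤ b)
    (hc : ContinuousOn c (Icc a b)) (hS : MapsTo c (Icc a b) S) :
    intrinsicEDist S (c a) (c b) ≤ eVariationOn c (Icc a b) := by
  have hmono : Monotone fun t : ℝ => a + t * (b - a) := fun s t hst =>
    add_le_add_right (mul_le_mul_of_nonneg_right hst (sub_nonneg.mpr hab)) a
  have hmaps : MapsTo (fun t : ℝ => a + t * (b - a)) (Icc 0 1) (Icc a b) := fun t ht =>
    ⟨by simpa using hmono ht.1, by simpa using hmono ht.2⟩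
  refine (iInf₂_le (c ∘ fun t : ℝ => a + t * (b - a))
    ⟨hc.comp (by fun_prop) hmaps, hS.comp hmaps, by simp, by simp⟩).trans ?_
  exact eVariationOn.comp_le_of_monotoneOn c _ (hmono.monotoneOn _) hmaps

lemma IsIntrinsicallyComplete.exists_tendsto (hS : IsIntrinsicallyComplete S) {c : ℝ → Euc m}
    {a b : ℝ} (hab : a < b) (hc : ContinuousOn c (Ico a b)) (hcS : MapsTo c (Ico a b) S)
    (hvar : BoundedVariationOn c (Ico a b)) : ∃ q ∈ S, Tendsto c (𝓝[<] b) (𝓝 q) := by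
  obtain ⟨s, hsmono, hs, hslim⟩ := exists_seq_strictMono_tendsto' hab
  have hs' (k) : s k ∈ Ico a b := Ioo_subset_Ico_self (hs k)
  have hdist {i j k : ℕ} (hij : i ≤ j) (hjk : j ≤ k) :
      intrinsicEDist S (c (s j)) (c (s k)) ≤ eVariationOn c (Ico a b ∩ Ico (s i) b) := by
    have hsub : Icc (s j) (s k) ⊆ Ico a b := fun t ht =>
      ⟨(hs' j).1.trans ht.1, ht.2.trans_lt (hs' k).2⟩
    refine (intrinsicEDist_le_eVariationOn (hsmono.monotone hjk) (hc.mono hsub)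
      (hcS.mono_left hsub)).trans (eVariationOn.mono c fun t ht => ⟨hsub ht, ?_, (hsub ht).2⟩)
    exact (hsmono.monotone hij).trans ht.1
  have hlim_var : Tendsto (fun k => eVariationOn c (Ico a b ∩ Ico (s k) b)) atTop (𝓝 0) :=
    (hvar.tendsto_eVariationOn_Ico_zero b).comp
      (tendsto_nhdsWithin_iff.mpr ⟨hslim, Eventually.of_forall hs'⟩)
  obtain ⟨q, hq, hlim⟩ := hS (fun k => c (s k)) (fun k => hcS (hs' k)) fun ε hε => by
    obtain ⟨N, hN⟩ := (hlim_var.eventually_lt_const hε).exists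
    refine ⟨N, fun j hj k hk => lt_of_le_of_lt ?_ hN⟩
    rcases le_total j k with hjk | hkj
    · exact hdist hj hjk
    · exact (intrinsicEDist_comm S _ _).trans_le (hdist hk hkj)
  have hlim_s : Tendsto (fun k => c (s k)) atTop (𝓝 q) :=
    tendsto_iff_edist_tendsto_0.mpr <| tendsto_of_tendsto_of_tendsto_of_le_of_le
      tendsto_const_nhds hlim (fun _ => zero_le) fun k => edist_le_intrinsicEDist S _ _
  obtain ⟨q', hq'⟩ := hvar.exists_tendsto_left b
  rw [inter_eq_left.mpr Ico_subset_Iio_self, nhdsWithin_Ico_eq_nhdsLT hab] at hq'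
  have hqq' : q' = q := tendsto_nhds_unique (hq'.comp (tendsto_nhdsWithin_iff.mpr
    ⟨hslim, Eventually.of_forall fun k => (hs k).2⟩)) hlim_s
  exact ⟨q, hq, hqq' ▸ hq'⟩

end IntrinsicDistance

section Properness

lemma eVariationOn_le_of_edist_le {α E F : Type*} [LinearOrder α] [PseudoEMetricSpace E]
    [PseudoEMetricSpace F] {f : α → E} {g : α → F} {s : Set α}
    (h : ∀ x ∈ s, ∀ y ∈ s, x ≤ y → edist (f x) (f y) ≤ edist (g x) (g y)) :
    eVariationOn f s ≤ eVariationOn g s := by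
  refine iSup_mono fun p => Finset.sum_le_sum fun i _ => ?_
  rw [edist_comm (f _), edist_comm (g _)]
  exact h _ (p.2.2.2 i) _ (p.2.2.2 (i + 1)) (p.2.2.1 i.le_succ)

lemma exists_monotoneOn_add_mul_of_convexOn {s : Set ℝ} {φ : ℝ → ℝ} (hφ : ConvexOn ℝ s φ)
    {a b : ℝ} (ha : a ∈ s) (hb : b ∈ s) (hab : a < b) :
    ∃ l, 0 ≤ l ∧ MonotoneOn (fun t => φ t + l * t) (s ∩ Ici b) := by
  refine ⟨|(φ b - φ a) / (b - a)|, abs_nonneg _, fun x hx y hy hxy => ?_⟩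
  rcases hxy.eq_or_lt with rfl | hxy
  · rfl
  have hax : a < x := hab.trans_le hx.2
  have hslope : (φ b - φ a) / (b - a) ≤ (φ y - φ x) / (y - x) :=
    (hφ.secant_mono ha hb hx.1 hab.ne' hax.ne' hx.2).trans
      (hφ.slope_mono_adjacent ha hy.1 hax hxy)
  have := (neg_abs_le _).trans hslope
  rw [le_div_iff₀ (sub_pos.mpr hxy)] at this
  linarith

variable {n : ℕ} {u : Euc n → ℝ} {r : ℝ}

lemma dist_graphMap_le (u : Euc n → ℝ) (x y : Euc n) :
    dist (graphMap u x) (graphMap u y) ≤ dist x y + dist (u x) (u y) := by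
  rw [graphMap_eq, graphMap_eq]
  refine (dist_add_add_le _ _ _ _).trans_eq ?_
  rw [(horizontalIncl n).dist_map, dist_eq_norm (u x • _), ← sub_smul, norm_smul, norm_eLast,
    mul_one, ← dist_eq_norm]

lemma smul_mem_ball_of_mem_Ico {E : Type*} [SeminormedAddCommGroup E] [NormedSpace ℝ E] {x : E}
    (hr : 0 < r) (hx : ‖x‖ ≤ r) {s : ℝ} (hs : s ∈ Ico (0 : ℝ) 1) : s • x ∈ ball (0 : E) r := by
  rw [mem_ball_zero_iff, norm_smul, Real.norm_of_nonneg hs.1]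
  nlinarith [hs.1, hs.2, norm_nonneg x]

lemma boundedVariationOn_graphMap_radial {x : Euc n}
    (hφ : ConvexOn ℝ (Ico (0 : ℝ) 1) fun s => u (s • x)) {M : ℝ}
    (hM : ∀ s ∈ Ico (0 : ℝ) 1, u (s • x) ≤ M) :
    BoundedVariationOn (fun s : ℝ => graphMap u (s • x)) (Ico (1 / 2) 1) := by
  obtain ⟨l, hl, hmono⟩ := exists_monotoneOn_add_mul_of_convexOn hφ
    (a := 0) (b := 1 / 2) (by norm_num) (by norm_num) (by norm_num)
  have hsub : Ico (1 / 2 : ℝ) 1 ⊆ Ico 0 1 ∩ Ici (1 / 2) := fun s hs =>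
    ⟨⟨by linarith [hs.1], hs.2⟩, hs.1⟩
  replace hmono := hmono.mono hsub
  let θ : ℝ → ℝ := fun s => u (s • x) + l * s + (l + ‖x‖) * s
  have hθmono : MonotoneOn θ (Ico (1 / 2) 1) :=
    hmono.add ((monotone_mul_left_of_nonneg (by positivity)).monotoneOn _)
  have hhalf : (1 / 2 : ℝ) ∈ Ico (1 / 2 : ℝ) 1 := by norm_num
  have hθbdd : ∀ s ∈ Ico (1 / 2 : ℝ) 1,
      |θ s| ≤ max |θ (1 / 2)| |M + l * 1 + (l + ‖x‖) * 1| := fun s hs => by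
    refine abs_le_max_abs_abs (hθmono hhalf hs hs.1) ?_
    have hus := hM s (hsub hs).1
    have hs1 := hs.2.le
    simp only [θ]
    gcongr
  refine ne_top_of_le_ne_top (hθmono.boundedVariationOn hθbdd)
    (eVariationOn_le_of_edist_le fun s hs t ht hst => ?_)
  rw [edist_dist, edist_dist]
  refine ENNReal.ofReal_le_ofReal ((dist_graphMap_le u _ _).trans ?_)
  have hmono_st : u (s • x) + l * s ≤ u (t • x) + l * t := hmono hs ht hst
  have hdist_u : dist (u (s • x)) (u (t • x)) ≤ u (t • x) - u (s • x) + 2 * l * (t - s) :=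
    abs_le.mpr ⟨by linarith [mul_nonneg hl (sub_nonneg.mpr hst)], by linarith⟩
  have hdist_x : dist (s • x) (t • x) = (t - s) * ‖x‖ := by
    rw [dist_eq_norm, ← sub_smul, norm_smul, Real.norm_eq_abs, abs_sub_comm,
      abs_of_nonneg (sub_nonneg.mpr hst)]
  calc dist (s • x) (t • x) + dist (u (s • x)) (u (t • x))
      ≤ θ t - θ s := by
        simp only [θ]
        linarith
    _ ≤ dist (θ s) (θ t) := by
        rw [dist_comm]
        exact le_abs_self _

lemma not_bddAbove_radial (hr : 0 < r) (hconv : ConvexOn ℝ (ball 0 r) u)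
    (hcont : ContinuousOn u (ball 0 r))
    (hcomplete : IsIntrinsicallyComplete (graphMap u '' ball 0 r)) {x : Euc n} (hx : ‖x‖ = r) :
    ¬ BddAbove ((fun s : ℝ => u (s • x)) '' Ico 0 1) := by
  rintro ⟨M, hM⟩
  have hmaps : MapsTo (fun s : ℝ => s • x) (Ico 0 1) (ball 0 r) := fun s hs =>
    smul_mem_ball_of_mem_Ico hr hx.le hs
  have hsub : Ico (1 / 2 : ℝ) 1 ⊆ Ico 0 1 := Ico_subset_Ico_left (by norm_num)
  have hradial : ConvexOn ℝ (Ico (0 : ℝ) 1) fun s => u (s • x) :=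
    (hconv.comp_linearMap (LinearMap.toSpanSingleton ℝ (Euc n) x)).subset hmaps (convex_Ico 0 1)
  have hcurve : ContinuousOn (fun s : ℝ => graphMap u (s • x)) (Ico (1 / 2) 1) := by
    simp only [graphMap_eq]
    exact ((horizontalIncl n).continuous.comp (by fun_prop)).continuousOn.add
      ((hcont.comp (by fun_prop) (hmaps.mono_left hsub)).smul continuousOn_const)
  obtain ⟨_, ⟨y, hy, rfl⟩, hlim⟩ := hcomplete.exists_tendsto (by norm_num) hcurve
    (fun s hs => mem_image_of_mem _ (hmaps (hsub hs)))
    (boundedVariationOn_graphMap_radial hradial fun s hs => hM (mem_image_of_mem _ hs))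
  have hproj : Continuous (baseProj : Euc (n + 1) → Euc n) := by
    unfold baseProj
    fun_prop
  have hlim_y : Tendsto (fun s : ℝ => s • x) (𝓝[<] 1) (𝓝 y) := by
    simpa [Function.comp_def] using (hproj.tendsto _).comp hlim
  have hlim_x : Tendsto (fun s : ℝ => s • x) (𝓝[<] 1) (𝓝 x) := by
    have : Continuous fun s : ℝ => s • x := by fun_prop
    simpa using (this.tendsto 1).mono_left nhdsWithin_le_nhds
  rw [tendsto_nhds_unique hlim_y hlim_x, mem_ball_zero_iff, hx] at hy
  exact lt_irrefl _ hy

lemma isCompact_sublevel (hr : 0 < r) (hconv : ConvexOn ℝ (ball 0 r) u)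
    (hcont : ContinuousOn u (ball 0 r))
    (hcomplete : IsIntrinsicallyComplete (graphMap u '' ball 0 r)) (M : ℝ) :
    IsCompact {x | x ∈ ball (0 : Euc n) r ∧ u x ≤ M} := by
  refine (isCompact_closedBall (0 : Euc n) r).of_isClosed_subset
    (IsSeqClosed.isClosed fun x y hx hlim => ?_) fun x hx => ball_subset_closedBall hx.1
  have hcontAt {z : Euc n} (hz : z ∈ ball 0 r) : ContinuousAt u z :=
    hcont.continuousAt (isOpen_ball.mem_nhds hz)
  have hy : ‖y‖ ≤ r := mem_closedBall_zero_iff.mp <| isClosed_closedBall.mem_of_tendsto hlim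
    (Eventually.of_forall fun k => ball_subset_closedBall (hx k).1)
  rcases hy.lt_or_eq with hlt | heq
  · have hyball : y ∈ ball (0 : Euc n) r := mem_ball_zero_iff.mpr hlt
    exact ⟨hyball, le_of_tendsto ((hcontAt hyball).tendsto.comp hlim)
      (Eventually.of_forall fun k => (hx k).2)⟩
  · refine (not_bddAbove_radial hr hconv hcont hcomplete heq ⟨max (u 0) M, ?_⟩).elim
    rintro _ ⟨s, hs, rfl⟩
    have hsy := smul_mem_ball_of_mem_Ico hr heq.le hs
    refine le_of_tendsto ((hcontAt hsy).tendsto.comp (hlim.const_smul s))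
      (Eventually.of_forall fun k => ?_)
    exact (hconv.le_max_of_mem_segment (mem_ball_self hr) (hx k).1
      ⟨1 - s, s, sub_nonneg.mpr hs.2.le, hs.1, by ring, by simp⟩).trans
      (max_le_max le_rfl (hx k).2)

end Properness

section SecondOrder

variable {E : Type*} [NormedAddCommGroup E] [NormedSpace ℝ E]

lemma hasDerivAt_comp_add_smul {F : Type*} [NormedAddCommGroup F] [NormedSpace ℝ F] {f : E → F}
    {x v : E} {s : ℝ} (hf : DifferentiableAt ℝ f (x + s • v)) :
    HasDerivAt (fun t : ℝ => f (x + t • v)) (fderiv ℝ f (x + s • v) v) s := by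
  have hline : HasDerivAt (fun t : ℝ => x + t • v) v s := by
    simpa using ((hasDerivAt_id s).smul_const v).const_add x
  exact hf.hasFDerivAt.comp_hasDerivAt s hline

lemma hasDerivAt_fderiv_comp_add_smul {f : E → ℝ} {x v : E} {s : ℝ}
    (hf : ContDiffAt ℝ 2 f (x + s • v)) :
    HasDerivAt (fun t : ℝ => fderiv ℝ f (x + t • v) v)
      (fderiv ℝ (fderiv ℝ f) (x + s • v) v v) s := by
  have hdf : DifferentiableAt ℝ (fderiv ℝ f) (x + s • v) :=
    (hf.fderiv_right (m := 1) (by norm_num)).differentiableAt (by norm_num)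
  simpa using (hasDerivAt_comp_add_smul hdf).clm_apply (hasDerivAt_const s v)

lemma convexOn_of_fderiv_fderiv_nonneg {s : Set E} (hs : IsOpen s) (hsc : Convex ℝ s) {f : E → ℝ}
    (hf : ContDiffOn ℝ 2 f s) (hpos : ∀ x ∈ s, ∀ v, 0 ≤ fderiv ℝ (fderiv ℝ f) x v v) :
    ConvexOn ℝ s f := by
  refine ⟨hsc, fun x hx y hy a b ha hb hab => ?_⟩
  have hmem {t : ℝ} (ht : t ∈ Icc (0 : ℝ) 1) : x + t • (y - x) ∈ s :=
    hsc.add_smul_sub_mem hx hy ht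
  have hfAt {t : ℝ} (ht : t ∈ Icc (0 : ℝ) 1) : ContDiffAt ℝ 2 f (x + t • (y - x)) :=
    hf.contDiffAt (hs.mem_nhds (hmem ht))
  have hderiv {t : ℝ} (ht : t ∈ Icc (0 : ℝ) 1) :=
    hasDerivAt_comp_add_smul ((hfAt ht).differentiableAt two_ne_zero)
  have hsegment : ConvexOn ℝ (Icc (0 : ℝ) 1) fun t => f (x + t • (y - x)) :=
    convexOn_of_hasDerivWithinAt2_nonneg (convex_Icc 0 1)
      (fun t ht => (hderiv ht).continuousAt.continuousWithinAt)
      (fun t ht => (hderiv (interior_subset ht)).hasDerivWithinAt)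
      (fun t ht =>
        (hasDerivAt_fderiv_comp_add_smul (hfAt (interior_subset ht))).hasDerivWithinAt)
      (fun t ht => hpos _ (hmem (interior_subset ht)) _)
  have hcomb : x + b • (y - x) = a • x + b • y := by
    rw [eq_sub_of_add_eq hab]
    module
  simpa [hcomb] using
    hsegment.2 (left_mem_Icc.mpr zero_le_one) (right_mem_Icc.mpr zero_le_one) ha hb hab

lemma deriv_deriv_nonneg_of_isLocalMin {f : ℝ → ℝ} {x : ℝ} (hmin : IsLocalMin f x)
    (hf : ContinuousAt f x) : 0 ≤ deriv (deriv f) x := by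
  by_contra! hneg
  have hmax : IsLocalMax f x := isLocalMax_of_deriv_deriv_neg hneg hmin.deriv_eq_zero hf
  have hconst : f =ᶠ[𝓝 x] fun _ => f x := by
    filter_upwards [hmin, hmax] with t hge hle using le_antisymm hle hge
  simp [hconst.deriv.deriv_eq] at hneg

lemma fderiv_fderiv_nonneg_of_isLocalMin {f : E → ℝ} {x : E} (hf : ContDiffAt ℝ 2 f x)
    (hmin : IsLocalMin f x) (v : E) : 0 ≤ fderiv ℝ (fderiv ℝ f) x v v := by
  have hline : ContinuousAt (fun t : ℝ => x + t • v) 0 := by fun_prop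
  have hline_tendsto : Tendsto (fun t : ℝ => x + t • v) (𝓝 0) (𝓝 x) := by
    simpa using hline.tendsto
  have hfx : ContDiffAt ℝ 2 f (x + (0 : ℝ) • v) := by simpa using hf
  have hderiv : deriv (fun t : ℝ => f (x + t • v)) =ᶠ[𝓝 0] fun t => fderiv ℝ f (x + t • v) v :=
    (hline_tendsto.eventually (hf.eventually (by simp))).mono fun t ht =>
      (hasDerivAt_comp_add_smul (ht.differentiableAt two_ne_zero)).deriv
  have hmin_line : IsLocalMin (fun t : ℝ => f (x + t • v)) 0 := by
    refine (hline_tendsto.eventually hmin).mono fun t ht => ?_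
    simpa using ht
  have hnonneg := deriv_deriv_nonneg_of_isLocalMin hmin_line
    (ContinuousAt.comp (g := f) hfx.continuousAt hline)
  rw [hderiv.deriv_eq, (hasDerivAt_fderiv_comp_add_smul hfx).deriv] at hnonneg
  simpa using hnonneg

lemma fderiv_fderiv_sub {f g : E → ℝ} {x : E} (hf : ContDiffAt ℝ 2 f x)
    (hg : ContDiffAt ℝ 2 g x) :
    fderiv ℝ (fderiv ℝ fun z => f z - g z) x =
      fderiv ℝ (fderiv ℝ f) x - fderiv ℝ (fderiv ℝ g) x := by
  have hderiv : fderiv ℝ (fun z => f z - g z) =ᶠ[𝓝 x] fderiv ℝ f - fderiv ℝ g := by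
    filter_upwards [hf.eventually (by simp), hg.eventually (by simp)] with z hfz hgz
    exact fderiv_fun_sub (hfz.differentiableAt two_ne_zero) (hgz.differentiableAt two_ne_zero)
  rw [hderiv.fderiv_eq]
  exact fderiv_sub ((hf.fderiv_right (m := 1) (by norm_num)).differentiableAt one_ne_zero)
    ((hg.fderiv_right (m := 1) (by norm_num)).differentiableAt one_ne_zero)

lemma fderiv_const_mul_comp_affine {f : E → ℝ} {x : E} (a : ℝ) (A : E →L[ℝ] E) (b : E)
    (hf : DifferentiableAt ℝ f (A x + b)) :
    fderiv ℝ (fun z => a * f (A z + b)) x = a • (fderiv ℝ f (A x + b)).comp A :=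
  ((hf.hasFDerivAt.comp x (A.hasFDerivAt.add_const b)).const_mul a).fderiv

lemma fderiv_fderiv_const_mul_comp_affine {f : E → ℝ} {x : E} (a : ℝ) (A : E →L[ℝ] E) (b : E)
    (hf : ContDiffAt ℝ 2 f (A x + b)) (v w : E) :
    fderiv ℝ (fderiv ℝ fun z => a * f (A z + b)) x v w =
      a * fderiv ℝ (fderiv ℝ f) (A x + b) (A v) (A w) := by
  have haffine : Tendsto (fun z => A z + b) (𝓝 x) (𝓝 (A x + b)) :=
    Continuous.tendsto (by fun_prop) x
  have hderiv : fderiv ℝ (fun z => a * f (A z + b)) =ᶠ[𝓝 x]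
      fun z => a • (fderiv ℝ f (A z + b)).comp A :=
    (haffine.eventually (hf.eventually (by simp))).mono fun z hz =>
      fderiv_const_mul_comp_affine a A b (hz.differentiableAt two_ne_zero)
  have hf' : HasFDerivAt (fderiv ℝ f) (fderiv ℝ (fderiv ℝ f) (A x + b)) (A x + b) :=
    ((hf.fderiv_right (m := 1) (by norm_num)).differentiableAt one_ne_zero).hasFDerivAt
  have hsecond := ((hf'.comp x (A.hasFDerivAt.add_const b)).clm_comp
    (hasFDerivAt_const A x)).const_smul a
  rw [hderiv.fderiv_eq]
  exact (DFunLike.congr_fun (DFunLike.congr_fun hsecond.fderiv v) w).trans (by simp)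

lemma fderiv_eq_of_isLocalMin_sub {f g : E → ℝ} {x : E} {a : ℝ} {A : E →L[ℝ] E} {b : E}
    (hf : DifferentiableAt ℝ f x) (hg : DifferentiableAt ℝ g (A x + b))
    (hmin : IsLocalMin (fun z => f z - a * g (A z + b)) x) :
    fderiv ℝ f x = a • (fderiv ℝ g (A x + b)).comp A := by
  have hg' : DifferentiableAt ℝ (fun z => a * g (A z + b)) x :=
    (hg.comp x (A.differentiableAt.add_const b)).const_mul a
  rw [← fderiv_const_mul_comp_affine a A b hg, ← sub_eq_zero, ← fderiv_fun_sub hf hg',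
    hmin.fderiv_eq_zero]

lemma fderiv_fderiv_le_of_isLocalMin_sub {f g : E → ℝ} {x : E} {a : ℝ} {A : E →L[ℝ] E} {b : E}
    (hf : ContDiffAt ℝ 2 f x) (hg : ContDiffAt ℝ 2 g (A x + b))
    (hmin : IsLocalMin (fun z => f z - a * g (A z + b)) x) (v : E) :
    a * fderiv ℝ (fderiv ℝ g) (A x + b) (A v) (A v) ≤ fderiv ℝ (fderiv ℝ f) x v v := by
  have hg' : ContDiffAt ℝ 2 (fun z => a * g (A z + b)) x :=
    contDiffAt_const.mul (hg.comp x (A.contDiff.contDiffAt.add contDiffAt_const))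
  have hnonneg := fderiv_fderiv_nonneg_of_isLocalMin (hf.sub hg') hmin v
  rw [fderiv_fderiv_sub hf hg'] at hnonneg
  simpa [fderiv_fderiv_const_mul_comp_affine a A b hg] using hnonneg

end SecondOrder

section Reflection

variable {E : Type*} [NormedAddCommGroup E] [InnerProductSpace ℝ E] {e : E} {r t : ℝ}

/-- The reflection in the affine hyperplane `⟨x, e⟩ = t`, where `e` is a unit vector. -/
noncomputable def hyperplaneReflection (e : E) (t : ℝ) (x : E) : E :=
  (ℝ ∙ e)ᗮ.reflection x + (2 * t) • e

lemma hyperplaneReflection_eq (he : ‖e‖ = 1) (t : ℝ) (x : E) :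
    hyperplaneReflection e t x = x - (2 * (inner ℝ x e - t)) • e := by
  rw [hyperplaneReflection, Submodule.reflection_orthogonal_apply,
    Submodule.reflection_singleton_apply, he, real_inner_comm]
  simp only [RCLike.ofReal_real_eq_id, id, one_pow, div_one]
  module

lemma norm_sub_smul_sq (he : ‖e‖ = 1) (x : E) (k : ℝ) :
    ‖x - k • e‖ ^ 2 = ‖x‖ ^ 2 - 2 * k * inner ℝ x e + k ^ 2 := by
  rw [norm_sub_sq_real, real_inner_smul_right, norm_smul, he, mul_one, Real.norm_eq_abs, sq_abs]
  ring

lemma norm_hyperplaneReflection_sq (he : ‖e‖ = 1) (t : ℝ) (x : E) :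
    ‖hyperplaneReflection e t x‖ ^ 2 = ‖x‖ ^ 2 - 4 * t * (inner ℝ x e - t) := by
  rw [hyperplaneReflection_eq he, norm_sub_smul_sq he]
  ring

lemma norm_hyperplaneReflection_le (he : ‖e‖ = 1) (ht : 0 ≤ t) {x : E} (hx : t ≤ inner ℝ x e) :
    ‖hyperplaneReflection e t x‖ ≤ ‖x‖ := by
  rw [← sq_le_sq₀ (norm_nonneg _) (norm_nonneg _), norm_hyperplaneReflection_sq he]
  linarith [mul_nonneg ht (sub_nonneg.mpr hx)]

lemma hyperplaneReflection_mem_segment (he : ‖e‖ = 1) (ht : 0 < t) {x : E} (hx : t ≤ inner ℝ x e)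
    (hx' : inner ℝ x e ≤ 2 * t) :
    hyperplaneReflection e t x ∈ segment ℝ (x - inner ℝ x e • e) x := by
  rw [hyperplaneReflection_eq he]
  set s : ℝ := inner ℝ x e
  have hs : 0 < s := ht.trans_le hx
  refine ⟨2 * (s - t) / s, 1 - 2 * (s - t) / s,
    div_nonneg (mul_nonneg zero_le_two (sub_nonneg.mpr hx)) hs.le, ?_, by ring, ?_⟩
  · rw [sub_nonneg, div_le_one hs]
    linarith
  · match_scalars <;> field_simp
    ring

lemma lt_of_lt_comp_hyperplaneReflection {u : E → ℝ} (hconv : ConvexOn ℝ (ball 0 r) u) {M : ℝ}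
    (hM : ∀ x ∈ closedBall (0 : E) √(r ^ 2 - t ^ 2), u x ≤ M) (he : ‖e‖ = 1) (ht : 0 < t) {x : E}
    (hx : x ∈ ball 0 r) (hxt : t ≤ inner ℝ x e) (hlt : u x < u (hyperplaneReflection e t x)) :
    u x < M := by
  have hM' {z : E} (hz : ‖z‖ ^ 2 ≤ r ^ 2 - t ^ 2) : u z ≤ M :=
    hM z (mem_closedBall_zero_iff.mpr (Real.le_sqrt_of_sq_le hz))
  have hxr : ‖x‖ < r := mem_ball_zero_iff.mp hx
  have hxr2 : ‖x‖ ^ 2 < r ^ 2 := pow_lt_pow_left₀ hxr (norm_nonneg _) two_ne_zero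
  have hproj := norm_sub_smul_sq he x (inner ℝ x e)
  rcases le_or_gt (inner ℝ x e) (2 * t) with hle | hgt
  · have hproj_mem : x - inner ℝ x e • e ∈ ball (0 : E) r := by
      rw [mem_ball_zero_iff]
      exact lt_of_le_of_lt (abs_le_of_sq_le_sq' (by nlinarith) (norm_nonneg x)).2 hxr
    rcases le_max_iff.mp (hconv.le_max_of_mem_segment hproj_mem hx
      (hyperplaneReflection_mem_segment he ht hxt hle)) with h | h
    · exact (hlt.trans_le h).trans_le (hM' (by nlinarith))
    · exact absurd hlt h.not_gt
  · refine hlt.trans_le (hM' ?_)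
    rw [norm_hyperplaneReflection_sq he]
    nlinarith

lemma exists_forall_lt_of_lt_comp_hyperplaneReflection [ProperSpace E] {u : E → ℝ} (hr : 0 < r)
    (hconv : ConvexOn ℝ (ball 0 r) u) (hcont : ContinuousOn u (ball 0 r)) (he : ‖e‖ = 1)
    (ht : 0 < t) :
    ∃ M, ∀ x ∈ ball 0 r, t ≤ inner ℝ x e → u x < u (hyperplaneReflection e t x) → u x < M := by
  have hsub : closedBall (0 : E) √(r ^ 2 - t ^ 2) ⊆ ball 0 r := by
    refine closedBall_subset_ball ((Real.sqrt_lt' hr).mpr ?_)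
    linarith [pow_pos ht 2]
  obtain ⟨M, hM⟩ :=
    ((isCompact_closedBall _ _).image_of_continuousOn (hcont.mono hsub)).bddAbove
  exact ⟨M, fun x hx hxt hlt => lt_of_lt_comp_hyperplaneReflection hconv
    (fun z hz => hM (mem_image_of_mem u hz)) he ht hx hxt hlt⟩

lemma exists_hyperplaneReflection_zero_eq {x y : E} (hxy : x ≠ y) (hnorm : ‖x‖ = ‖y‖) :
    ∃ e : E, ‖e‖ = 1 ∧ 0 < inner ℝ x e ∧ hyperplaneReflection e 0 x = y := by
  have hpos : 0 < ‖x - y‖ := norm_pos_iff.mpr (sub_ne_zero.mpr hxy)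
  have he : ‖‖x - y‖⁻¹ • (x - y)‖ = 1 := norm_smul_inv_norm (𝕜 := ℝ) (sub_ne_zero.mpr hxy)
  have hinner_sub : inner ℝ x (x - y) = ‖x - y‖ ^ 2 / 2 := by
    rw [inner_sub_right, real_inner_self_eq_norm_sq, norm_sub_sq_real, ← hnorm]
    ring
  have hinner : inner ℝ x (‖x - y‖⁻¹ • (x - y)) = ‖x - y‖ / 2 := by
    rw [real_inner_smul_right, hinner_sub]
    field_simp
  refine ⟨‖x - y‖⁻¹ • (x - y), he, hinner ▸ half_pos hpos, ?_⟩
  rw [hyperplaneReflection_eq he, hinner, sub_zero, mul_div_cancel₀ _ two_ne_zero,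
    smul_inv_smul₀ hpos.ne', sub_sub_cancel]

end Reflection

section Shrinking

variable {E : Type*} [NormedAddCommGroup E] [NormedSpace ℝ E] {U : Set E} {f : E → ℝ}

lemma eventually_forall_abs_mul_comp_smul_sub_lt (hU : IsOpen U) (hf : ContinuousOn f U)
    {K : Set E} (hK : IsCompact K) (hKU : K ⊆ U) {ε : ℝ} (hε : 0 < ε) :
    ∀ᶠ c in 𝓝 (1 : ℝ), ∀ z ∈ K, c⁻¹ • z ∈ U ∧ |c * f (c⁻¹ • z) - f z| < ε := by
  refine hK.eventually_forall_of_forall_eventually fun z hz => ?_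
  have hfz : ContinuousAt f z := hf.continuousAt (hU.mem_nhds (hKU hz))
  have hscale : ContinuousAt (fun q : ℝ × E => q.1⁻¹ • q.2) (1, z) :=
    (continuousAt_fst.inv₀ one_ne_zero).smul continuousAt_snd
  have hdiff : ContinuousAt (fun q : ℝ × E => |q.1 * f (q.1⁻¹ • q.2) - f q.2|) (1, z) :=
    ((continuousAt_fst.mul (ContinuousAt.comp (g := f) (by simpa using hfz) hscale)).sub
      (ContinuousAt.comp (g := f) hfz continuousAt_snd)).abs
  exact (hscale.eventually_mem (hU.mem_nhds (by simpa using hKU hz))).and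
    (hdiff.eventually_lt_const (by simpa using hε))

lemma exists_isMinOn_sub_mul_comp_smul (hU : IsOpen U) (hf : ContinuousOn f U) {D : Set E}
    (hD : IsCompact D) (hDU : D ⊆ U) {ρ : E → E} (hρ : ContinuousOn ρ D) (hρU : MapsTo ρ D U)
    {x : E} (hx : x ∈ D) (hlt : f x < f (ρ x)) :
    ∃ c ∈ Ioo (0 : ℝ) 1, ∃ y ∈ D, c⁻¹ • ρ y ∈ U ∧ f y < f (ρ y) ∧
      IsMinOn (fun z => f z - c * f (c⁻¹ • ρ z)) D y := by
  have hclose := eventually_forall_abs_mul_comp_smul_sub_lt hU hf (hD.image_of_continuousOn hρ)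
    hρU.image_subset (half_pos (sub_pos.mpr hlt))
  obtain ⟨c, hcD, hc⟩ : ∃ c : ℝ, (∀ z ∈ ρ '' D, c⁻¹ • z ∈ U ∧
      |c * f (c⁻¹ • z) - f z| < (f (ρ x) - f x) / 2) ∧ c ∈ Ioo (0 : ℝ) 1 :=
    ((hclose.filter_mono nhdsWithin_le_nhds).and (Ioo_mem_nhdsLT one_pos)).exists
  replace hcD {z : E} (hz : z ∈ D) := hcD (ρ z) (mem_image_of_mem ρ hz)
  obtain ⟨y, hy, hmin⟩ := hD.exists_isMinOn ⟨x, hx⟩ (f := fun z => f z - c * f (c⁻¹ • ρ z))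
    ((hf.mono hDU).sub (continuousOn_const.mul
      (hf.comp (hρ.const_smul c⁻¹) fun z hz => (hcD hz).1)))
  refine ⟨c, hc, y, hy, (hcD hy).1, ?_, hmin⟩
  have hyx : f y - c * f (c⁻¹ • ρ y) ≤ f x - c * f (c⁻¹ • ρ x) := hmin hx
  linarith [(abs_lt.mp (hcD hx).2).1, (abs_lt.mp (hcD hy).2).2]

end Shrinking

section Translator

variable {n : ℕ} {Γ : Set (Fin n → ℝ)} {γ : (Fin n → ℝ) → ℝ} {r : ℝ} {u : Euc n → ℝ}

/-- The open cone `Γ₊` of vectors with positive entries. -/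
def positiveCone (n : ℕ) : Set (Fin n → ℝ) :=
  {l | ∀ i, 0 < l i}

lemma convex_positiveCone (n : ℕ) : Convex ℝ (positiveCone n) := by
  simpa [positiveCone, Set.pi] using
    convex_pi (s := univ) fun (_ : Fin n) _ => convex_Ioi (0 : ℝ)

lemma map_pos_of_pos_of_single_pos {ι : Type*} [Finite ι] [DecidableEq ι]
    {L : (ι → ℝ) →L[ℝ] ℝ} (hL : ∀ i, 0 < L (Pi.single i 1)) {v : ι → ℝ} (hv : 0 < v) :
    0 < L v := by
  have := Fintype.ofFinite ι
  rw [pi_eq_sum_univ' v, map_sum]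
  obtain ⟨hnonneg, i, hi⟩ := Pi.lt_def.mp hv
  refine Finset.sum_pos' (fun j _ => ?_) ⟨i, Finset.mem_univ i, ?_⟩
  · simpa [Pi.single_apply] using mul_nonneg (hnonneg j) (hL j).le
  · simpa using mul_pos hi (hL i)

lemma IsSpeedFunction.strictMonoOn_positiveCone {α : ℝ} (hγ : IsSpeedFunction Γ γ α) :
    StrictMonoOn γ (positiveCone n) := by
  intro l hl m hm hlm
  have hmem {t : ℝ} (ht : t ∈ Icc (0 : ℝ) 1) : l + t • (m - l) ∈ Γ :=
    hγ.pos_cone_subset ((convex_positiveCone n).add_smul_sub_mem hl hm ht)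
  have hderiv {t : ℝ} (ht : t ∈ Icc (0 : ℝ) 1) :=
    hasDerivAt_comp_add_smul (((hγ.smooth.contDiffAt
      (hγ.isOpen.mem_nhds (hmem ht))).differentiableAt (by norm_num)))
  have hmono : StrictMonoOn (fun t : ℝ => γ (l + t • (m - l))) (Icc 0 1) := by
    refine strictMonoOn_of_deriv_pos (convex_Icc 0 1)
      (fun t ht => (hderiv ht).continuousAt.continuousWithinAt) fun t ht => ?_
    rw [(hderiv (interior_subset ht)).deriv]
    exact map_pos_of_pos_of_single_pos (hγ.increasing _ (hmem (interior_subset ht)))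
      (sub_pos.mpr hlm)
  simpa using hmono (left_mem_Icc.mpr zero_le_one) (right_mem_Icc.mpr zero_le_one) one_pos

lemma isGraphTranslator_image_graphMap_iff {s : Set (Euc n)} :
    IsGraphTranslator Γ γ u (graphMap u '' s) ↔
      ∀ x ∈ s, principalCurvatures (graphMap u) (graphNormal u) x ∈ Γ ∧
        γ (principalCurvatures (graphMap u) (graphNormal u) x) =
          inner ℝ (graphNormal u x) (eLast n) := by
  simp [IsGraphTranslator, graphCurvatures]

lemma IsGraphTranslator.convexOn {s : Set (Euc n)} (hs : IsOpen s) (hsc : Convex ℝ s)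
    (hu : ContDiffOn ℝ 2 u s) (htr : IsGraphTranslator (positiveCone n) γ u (graphMap u '' s)) :
    ConvexOn ℝ s u :=
  convexOn_of_fderiv_fderiv_nonneg hs hsc hu fun x hx =>
    hessian_nonneg_of_principalCurvatures_nonneg (hu.contDiffAt (hs.mem_nhds hx)) fun i =>
      ((isGraphTranslator_image_graphMap_iff.mp htr x hx).1 i).le

/-- Shrinking a graph by `c < 1` multiplies its curvatures by `c⁻¹` and keeps its normals. -/
lemma IsGraphTranslator.not_isLocalMin_sub_mul_comp [Nonempty (Fin n)]
    (hγ : StrictMonoOn γ (positiveCone n)) {s : Set (Euc n)} (hs : IsOpen s)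
    (hu : ContDiffOn ℝ 2 u s) (htr : IsGraphTranslator (positiveCone n) γ u (graphMap u '' s))
    (R : Euc n ≃ₗᵢ[ℝ] Euc n) (w : Euc n) {c : ℝ} (hc : c ∈ Ioo (0 : ℝ) 1) {x : Euc n}
    (hx : x ∈ s) (hy : c⁻¹ • (R x + w) ∈ s) :
    ¬ IsLocalMin (fun z => u z - c * u (c⁻¹ • (R z + w))) x := by
  intro hmin
  set A : Euc n →L[ℝ] Euc n := c⁻¹ • R.toContinuousLinearEquiv.toContinuousLinearMap
  have hA (z : Euc n) : A z = c⁻¹ • R z := rfl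
  simp only [smul_add, ← hA] at hy hmin
  have hux := hu.contDiffAt (hs.mem_nhds hx)
  have huy := hu.contDiffAt (hs.mem_nhds hy)
  have hgrad (v : Euc n) : fderiv ℝ u (A x + c⁻¹ • w) (R v) = fderiv ℝ u x v := by
    rw [fderiv_eq_of_isLocalMin_sub (hux.differentiableAt two_ne_zero)
      (huy.differentiableAt two_ne_zero) hmin]
    simp [hA, hc.1.ne']
  have hhess (v : Euc n) : c⁻¹ * fderiv ℝ (fderiv ℝ u) (A x + c⁻¹ • w) (R v) (R v) ≤
      fderiv ℝ (fderiv ℝ u) x v v := by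
    refine Eq.trans_le ?_ (fderiv_fderiv_le_of_isLocalMin_sub hux huy hmin v)
    simp [hA, hc.1.ne']
  obtain ⟨hxpos, hγx⟩ := isGraphTranslator_image_graphMap_iff.mp htr _ hx
  obtain ⟨hypos, hγy⟩ := isGraphTranslator_image_graphMap_iff.mp htr _ hy
  have hcurv : StrongLT (principalCurvatures (graphMap u) (graphNormal u) (A x + c⁻¹ • w))
      (principalCurvatures (graphMap u) (graphNormal u) x) := fun i =>
    (lt_mul_of_one_lt_left (hypos i) ((one_lt_inv₀ hc.1).mpr hc.2)).trans_le
      (mul_principalCurvatures_graph_le hux huy R hgrad (inv_nonneg.mpr hc.1.le) hhess i)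
  refine (hγ hypos hxpos hcurv.lt).ne ?_
  rw [hγx, hγy, inner_graphNormal_eLast_congr R hgrad]

lemma IsGraphTranslator.comp_hyperplaneReflection_le (hγ : StrictMonoOn γ (positiveCone n))
    (hr : 0 < r) (hu : ContDiffOn ℝ 2 u (ball 0 r))
    (hcomplete : IsIntrinsicallyComplete (graphMap u '' ball 0 r))
    (htr : IsGraphTranslator (positiveCone n) γ u (graphMap u '' ball 0 r))
    {e : Euc n} (he : ‖e‖ = 1) {t : ℝ} (ht : 0 < t) {x : Euc n} (hx : x ∈ ball (0 : Euc n) r)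
    (hxt : t ≤ inner ℝ x e) : u (hyperplaneReflection e t x) ≤ u x := by
  by_contra! hlt
  have hconv : ConvexOn ℝ (ball 0 r) u := htr.convexOn isOpen_ball (convex_ball 0 r) hu
  obtain ⟨M, hM⟩ := exists_forall_lt_of_lt_comp_hyperplaneReflection hr hconv
    hu.continuousOn he ht
  have hinner : Continuous fun z : Euc n => (inner ℝ z e : ℝ) := by fun_prop
  let D : Set (Euc n) := {z | z ∈ ball 0 r ∧ u z ≤ M} ∩ {z | t ≤ inner ℝ z e}
  have hD : IsCompact D := (isCompact_sublevel hr hconv hu.continuousOn hcomplete M).inter_right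
    (isClosed_le continuous_const hinner)
  have hxD : x ∈ D := ⟨⟨hx, (hM x hx hxt hlt).le⟩, hxt⟩
  have hρ : Continuous (hyperplaneReflection e t) := by
    unfold hyperplaneReflection
    fun_prop
  have hρD : MapsTo (hyperplaneReflection e t) D (ball 0 r) := fun z hz =>
    mem_ball_zero_iff.mpr <|
      (norm_hyperplaneReflection_le he ht.le hz.2).trans_lt (mem_ball_zero_iff.mp hz.1.1)
  obtain ⟨c, hc, y, hyD, hcy, hylt, hmin⟩ := exists_isMinOn_sub_mul_comp_smul isOpen_ball
    hu.continuousOn hD (fun z hz => hz.1.1) hρ.continuousOn hρD hxD hlt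
  have hyt : t < inner ℝ y e := by
    refine lt_of_le_of_ne hyD.2 fun h => ?_
    simp [hyperplaneReflection_eq he, ← h] at hylt
  have hyM : u y < M := hM y hyD.1.1 hyD.2 hylt
  have hDy : D ∈ 𝓝 y := by
    have hball : ball (0 : Euc n) r ∈ 𝓝 y := isOpen_ball.mem_nhds hyD.1.1
    filter_upwards [hball, (hu.continuousOn.continuousAt hball).eventually_lt_const hyM,
      (hinner.tendsto y).eventually_const_lt hyt] with z hz hzM hzt
    exact ⟨⟨hz, hzM.le⟩, hzt.le⟩
  have : Nonempty (Fin n) := by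
    by_contra! hn
    simp [Subsingleton.elim e 0] at he
  exact htr.not_isLocalMin_sub_mul_comp hγ isOpen_ball hu _ _ hc hyD.1.1 hcy (hmin.isLocalMin hDy)

lemma IsGraphTranslator.le_of_norm_eq (hγ : StrictMonoOn γ (positiveCone n)) (hr : 0 < r)
    (hu : ContDiffOn ℝ 2 u (ball 0 r))
    (hcomplete : IsIntrinsicallyComplete (graphMap u '' ball 0 r))
    (htr : IsGraphTranslator (positiveCone n) γ u (graphMap u '' ball 0 r))
    {x y : Euc n} (hx : x ∈ ball (0 : Euc n) r) (hxy : ‖x‖ = ‖y‖) : u y ≤ u x := by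
  rcases eq_or_ne x y with rfl | hne
  · exact le_rfl
  obtain ⟨e, he, hxe, hy⟩ := exists_hyperplaneReflection_zero_eq hne hxy
  have hyball : y ∈ ball (0 : Euc n) r := by simpa [← hxy] using hx
  have hρ : Continuous fun t => hyperplaneReflection e t x := by
    unfold hyperplaneReflection
    fun_prop
  have hlim : Tendsto (fun t => u (hyperplaneReflection e t x)) (𝓝[>] 0) (𝓝 (u y)) :=
    (hu.continuousOn.continuousAt (isOpen_ball.mem_nhds hyball)).tendsto.comp
      ((hy ▸ hρ.tendsto 0).mono_left nhdsWithin_le_nhds)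
  refine le_of_tendsto hlim ?_
  filter_upwards [Ioo_mem_nhdsGT hxe] with t ht
  exact htr.comp_hyperplaneReflection_le hγ hr hu hcomplete he ht.1 hx ht.2.le

end Translator

section RotationalSymmetry

variable {n : ℕ}

lemma exists_horizontalIncl_eq_of_map_eLast {A : Euc (n + 1) ≃ₗᵢ[ℝ] Euc (n + 1)}
    (hA : A (eLast n) = eLast n) (x : Euc n) :
    ∃ y, A (horizontalIncl n x) = horizontalIncl n y ∧ ‖y‖ = ‖x‖ := by
  have hlast : A (horizontalIncl n x) (Fin.last n) = 0 := by
    have horth : inner ℝ (A (horizontalIncl n x)) (eLast n) = 0 := by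
      rw [← hA, A.inner_map_map, inner_horizontalIncl_eLast]
    simpa [eLast, EuclideanSpace.inner_single_right] using horth
  have hy : A (horizontalIncl n x) = horizontalIncl n (baseProj (A (horizontalIncl n x))) := by
    ext i
    refine Fin.lastCases ?_ (fun j => ?_) i
    · simp [hlast]
    · simp [baseProj]
  refine ⟨_, hy, ?_⟩
  rw [← (horizontalIncl n).norm_map, ← hy, A.norm_map, (horizontalIncl n).norm_map]

lemma isRotationallySymmetric_image_graphMap_ball {r : ℝ} {u : Euc n → ℝ}
    (hu : ∀ x ∈ ball (0 : Euc n) r, ∀ y, ‖x‖ = ‖y‖ → u x = u y) :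
    IsRotationallySymmetric (graphMap u '' ball 0 r) := by
  have hsub (A : Euc (n + 1) ≃ₗᵢ[ℝ] Euc (n + 1)) (hA : A (eLast n) = eLast n) :
      A '' (graphMap u '' ball 0 r) ⊆ graphMap u '' ball 0 r := by
    rintro _ ⟨_, ⟨x, hx, rfl⟩, rfl⟩
    obtain ⟨y, hAx, hyx⟩ := exists_horizontalIncl_eq_of_map_eLast hA x
    refine ⟨y, by simpa [hyx] using hx, ?_⟩
    rw [graphMap_eq, graphMap_eq, map_add, map_smul, hA, hAx, hu x hx y hyx.symm]
  refine fun A hA => (hsub A hA).antisymm fun p hp => ⟨A.symm p, hsub A.symm ?_ ⟨p, hp, rfl⟩, ?_⟩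
  · rw [A.symm_apply_eq, hA]
  · exact A.apply_symm_apply p

end RotationalSymmetry

theorem theorem1p4_general {n : ℕ} {γ : (Fin n → ℝ) → ℝ} {r : ℝ} {u : Euc n → ℝ}
    (hγ : StrictMonoOn γ (positiveCone n)) (hu : ContDiffOn ℝ 2 u (ball 0 r))
    (hcomplete : IsIntrinsicallyComplete (graphMap u '' ball 0 r))
    (htranslator : IsGraphTranslator (positiveCone n) γ u (graphMap u '' ball 0 r)) :
    IsRotationallySymmetric (graphMap u '' ball 0 r) := by
  refine isRotationallySymmetric_image_graphMap_ball fun x hx y hxy => ?_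
  have hr : 0 < r := pos_of_mem_ball hx
  have hy : y ∈ ball (0 : Euc n) r := by simpa [← hxy] using hx
  exact (htranslator.le_of_norm_eq hγ hr hu hcomplete hy hxy.symm).antisymm
    (htranslator.le_of_norm_eq hγ hr hu hcomplete hx hxy)

theorem theorem1p4 (n : ℕ) (hn : 2 ≤ n) (Γ : Set (Fin n → ℝ)) (γ : (Fin n → ℝ) → ℝ) (α : ℝ)
    (hγ : IsSpeedFunction Γ γ α) (r : ℝ) (hr : 0 < r) (u : Euc n → ℝ)
    (hu : ContDiffOn ℝ ∞ u (Metric.ball 0 r)) (S : Set (Euc (n + 1)))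
    (hgraph : S = graphMap u '' Metric.ball 0 r)
    (hcomplete : IsIntrinsicallyComplete S)
    (htranslator : IsGraphTranslator Γ γ u S)
    (hconvex : ∀ p ∈ S, ∀ i, 0 < graphCurvatures u p i)
    (hend : HasSingleEnd S)
    (hasymptotic : IsAsymptoticToCylinder S (graphCurvatures u) r) :
    IsRotationallySymmetric S := by
  subst hgraph
  exact theorem1p4_general hγ.strictMonoOn_positiveCone (hu.of_le (mod_cast ENat.LEInfty.out))
    hcomplete fun p hp => ⟨hconvex p hp, (htranslator p hp).2⟩
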